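/- Conventions. A convex body is a compact convex subset of $\mathbb{R}^n$ with non-empty interior. For a convex body $K$ let $h_K(u)=\max_{y\in K}\langle y,u\rangle$ be its support function, $K^u=\{x\in K:\langle x,u\rangle=h_K(u)\}$, and let $S_K$ be its surface area measure, i.e. the Borel measure on $\mathbb{S}^{n-1}$ with $S_K(B)=\mathcal{H}^{n-1}\big(\bigcup_{u\in B}K^u\big)$ for Borel $B\subset\mathbb{S}^{n-1}$. Convex bodies $K,L$ are homothetic if $L=x+tK$ for some $t>0$ and $x\in\mathbb{R}^n$. A convex body $K$ is weakly decomposable if there is a convex body $L$, not homothetic to $K$, with $\mathrm{supp}(S_{K+L})\subset\mathrm{supp}(S_K)$. For $n\ge 2$ and a convex body $K$ put $$b_2(K)=\sup_{A,B}\frac{V(A,B,K[n-2])\,V(K)}{V(A,K[n-1])\,V(B,K[n-1])},$$ the supremum being over all convex bodies $A,B\subset\mathbb{R}^n$ containing the origin in their interiors; here $V(K)$ is the volume of $K$ and $V(K_1,\dots,K_n)$ is the mixed volume, $n!\,V(K_1,\dots,K_n)=\sum_{\emptyset\ne J\subset\{1,\dots,n\}}(-1)^{n-|J|}\mathrm{Vol}_n\big(\sum_{j\in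 J}K_j\big)$, and $K[m]$ means that $K$ is repeated $m$ times. Lemma. (i) Every full-dimensional polytope $P\subset\mathbb{R}^n$ which is not an $n$-simplex is weakly decomposable. (ii) An $n$-simplex in $\mathbb{R}^n$ is not weakly decomposable. (iii) Consequently, for $n\ge2$, the statement "every weakly decomposable convex body $K\subset\mathbb{R}^n$ satisfies $b_2(K)>1$" implies the statement "every full-dimensional polytope $P\subset\mathbb{R}^n$ which is not an $n$-simplex satisfies $b_2(P)>1$". -/

import Mathlib

open MeasureTheory MeasureTheory.Measure Set
open scoped Pointwise

/-- Euclidean space `ℝⁿ`. -/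
abbrev Eucl (n : ℕ) : Type := EuclideanSpace ℝ (Fin n)

/-- The unit sphere `𝕊ⁿ⁻¹` of `ℝⁿ`, as a type (with its Borel σ-algebra). -/
abbrev USphere (n : ℕ) : Type := Metric.sphere (0 : Eucl n) 1

/-- A convex body: a compact convex subset of `ℝⁿ` with non-empty interior. -/
structure IsBody {n : ℕ} (K : Set (Eucl n)) : Prop where
  isCompact : IsCompact K
  convex : Convex ℝ K
  interior_nonempty : (interior K).Nonempty

/-- The Minkowski sum of two convex bodies is a convex body. -/
theorem IsBody.add {n : ℕ} {K L : Set (Eucl n)} (hK : IsBody K) (hL : IsBody L) :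
    IsBody (K + L) where
  isCompact := hK.isCompact.add hL.isCompact
  convex := hK.convex.add hL.convex
  interior_nonempty := by
    obtain ⟨x, hx⟩ := hK.interior_nonempty
    obtain ⟨y, hy⟩ := hL.interior_nonempty
    exact ⟨x + y, subset_interior_add_left (Set.add_mem_add hx (interior_subset hy))⟩

/-- The support function `h_K(u) = max_{y ∈ K} ⟨y, u⟩`. -/
noncomputable def supportFun {n : ℕ} (K : Set (Eucl n)) (u : Eucl n) : ℝ :=
  sSup ((fun y => inner ℝ y u) '' K)

/-- The face `K^u = {x ∈ K : ⟨x, u⟩ = h_K(u)}`. -/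
def faceIn {n : ℕ} (K : Set (Eucl n)) (u : Eucl n) : Set (Eucl n) :=
  {x | x ∈ K ∧ inner ℝ x u = supportFun K u}

/-- The inverse spherical image `τ(K, B) = ⋃_{u ∈ B} K^u` of `B ⊆ 𝕊ⁿ⁻¹`. -/
def invSphericalImage {n : ℕ} (K : Set (Eucl n)) (B : Set (USphere n)) : Set (Eucl n) :=
  ⋃ u ∈ B, faceIn K (u : Eucl n)

theorem IsBody.mem_faceIn {n : ℕ} {K : Set (Eucl n)} (hK : IsBody K) {u x : Eucl n} :
    x ∈ faceIn K u ↔ x ∈ K ∧ ∀ y ∈ K, inner ℝ y u ≤ inner ℝ x u := by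
  have hbdd : BddAbove ((fun y : Eucl n => inner ℝ y u) '' K) :=
    (hK.isCompact.image (by fun_prop)).bddAbove
  constructor
  · rintro ⟨hx, he⟩
    refine ⟨hx, fun y hy => ?_⟩
    rw [he]
    exact le_csSup hbdd ⟨y, hy, rfl⟩
  · rintro ⟨hx, h⟩
    refine ⟨hx, le_antisymm (le_csSup hbdd ⟨x, hx, rfl⟩) ?_⟩
    refine csSup_le ⟨_, x, hx, rfl⟩ ?_
    rintro _ ⟨y, hy, rfl⟩
    exact h y hy

/-- The set function `B ↦ ℋⁿ⁻¹(τ(K, B))`, defined on all subsets of the sphere. -/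
noncomputable def surfaceOuter {n : ℕ} (K : Set (Eucl n)) : OuterMeasure (USphere n) where
  measureOf B := μHE[n - 1] (invSphericalImage K B)
  empty := by simp [invSphericalImage]
  mono := fun h => measure_mono (Set.biUnion_subset_biUnion_left h)
  iUnion_nat := fun s _ => by
    refine le_trans (measure_mono ?_) (measure_iUnion_le _)
    intro x hx
    simp only [invSphericalImage, Set.mem_iUnion] at hx ⊢
    obtain ⟨u, ⟨i, hi⟩, hx⟩ := hx
    exact ⟨i, u, hi, hx⟩

/-- An `(n-2)`-dimensional affine subspace is `ℋⁿ⁻¹`-null. -/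
theorem hausdorff_codimTwo_null {n : ℕ} (a b : Eucl n) (α β : ℝ)
    (hab : LinearIndependent ℝ ![a, b]) :
    μH[((n - 1 : ℕ) : ℝ)] {y : Eucl n | inner ℝ a y = α ∧ inner ℝ b y = β} = 0 := by
  rcases Set.eq_empty_or_nonempty {y : Eucl n | inner ℝ a y = α ∧ inner ℝ b y = β} with he | ⟨y₀, h₀⟩
  · rw [he]; simp
  set S := Submodule.span ℝ (Set.range ![a, b]) with hS
  have hSr : Module.finrank ℝ S = 2 := by
    rw [hS, finrank_span_eq_card hab]; simp
  have htot := Submodule.finrank_add_finrank_orthogonal S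
  rw [hSr] at htot
  have hn : Module.finrank ℝ (Eucl n) = n := by simp
  rw [hn] at htot
  have haS : a ∈ S := Submodule.subset_span ⟨0, rfl⟩
  have hbS : b ∈ S := Submodule.subset_span ⟨1, rfl⟩
  have hsub : {y : Eucl n | inner ℝ a y = α ∧ inner ℝ b y = β} ⊆
      (fun w : Sᗮ => y₀ + (w : Eucl n)) '' Set.univ := by
    rintro y ⟨hy1, hy2⟩
    have hmem : y - y₀ ∈ Sᗮ := by
      rw [Submodule.mem_orthogonal]
      intro s hs
      induction hs using Submodule.span_induction with
      | mem x hx =>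
        obtain ⟨i, rfl⟩ := hx
        fin_cases i
        · simp [inner_sub_right, hy1, h₀.1]
        · simp [inner_sub_right, hy2, h₀.2]
      | zero => simp
      | add x y _ _ hx hy => rw [inner_add_left, hx, hy, add_zero]
      | smul c x _ hx => rw [inner_smul_left, hx, mul_zero]
    exact ⟨⟨y - y₀, hmem⟩, Set.mem_univ _, by simp⟩
  have hiso : Isometry (fun w : Sᗮ => y₀ + (w : Eucl n)) :=
    (IsometryEquiv.addLeft y₀).isometry.comp Sᗮ.subtypeₗᵢ.isometry
  refine measure_mono_null hsub ?_
  have hlt : dimH ((fun w : Sᗮ => y₀ + (w : Eucl n)) '' Set.univ) < ((n - 1 : ℕ) : NNReal) := by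
    rw [hiso.dimH_image, Real.dimH_univ_eq_finrank]
    have : Module.finrank ℝ Sᗮ < n - 1 := by omega
    exact_mod_cast this
  have := hausdorffMeasure_of_dimH_lt hlt
  rwa [NNReal.coe_natCast] at this

/-- The points of a convex body with at least two unit outer normals form an `ℋⁿ⁻¹`-null set:
such a point is the metric projection of a point lying on one of countably many affine subspaces
of dimension `n - 2`. -/
theorem IsBody.singular_null {n : ℕ} {K : Set (Eucl n)} (hK : IsBody K) :
    μHE[n - 1] {x : Eucl n | ∃ u v : USphere n, u ≠ v ∧
      x ∈ faceIn K (u : Eucl n) ∧ x ∈ faceIn K (v : Eucl n)} = 0 := by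
  let Q := Eucl n × Eucl n × ℝ × ℝ
  let A : Q → Set (Eucl n) := fun q =>
    {y | inner ℝ q.1 y = q.2.2.1 ∧ inner ℝ q.2.1 y = q.2.2.2}
  let R : Eucl n → Eucl n → Prop := fun x y => x ∈ K ∧ ∀ z ∈ K, inner ℝ (z - x) (y - x) ≤ 0
  let P : Q → Set (Eucl n) := fun q => {x | ∃ y ∈ A q, R x y}
  -- the projection is 1-Lipschitz
  have hlip : ∀ x y x' y', R x y → R x' y' → dist x x' ≤ dist y y' := by
    intro x y x' y' h h'
    have h1 := h.2 x' h'.1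
    have h2 := h'.2 x h.1
    have h3 : ‖x - x'‖ ^ 2 ≤ inner ℝ (x - x') (y - y') := by
      rw [← real_inner_self_eq_norm_sq]
      simp only [inner_sub_left, inner_sub_right] at h1 h2 ⊢
      linarith
    have h4 := real_inner_le_norm (x - x') (y - y')
    rw [dist_eq_norm, dist_eq_norm]
    by_contra hcon
    push Not at hcon
    nlinarith [norm_nonneg (x - x'), norm_nonneg (y - y')]
  have hPnull : ∀ q : Q, LinearIndependent ℝ ![q.1, q.2.1] →
      μH[((n - 1 : ℕ) : ℝ)] (P q) = 0 := by
    intro q hq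
    let A' : Set (Eucl n) := {y | y ∈ A q ∧ ∃ x, R x y}
    choose! f hf using (fun (y : Eucl n) (hy : y ∈ A') => hy.2)
    have hfl : LipschitzOnWith 1 f A' := by
      refine LipschitzOnWith.of_dist_le_mul fun y hy y' hy' => ?_
      simpa using hlip _ _ _ _ (hf y hy) (hf y' hy')
    have hsub : P q ⊆ f '' A' := by
      rintro x ⟨y, hyA, hxy⟩
      have hyA' : y ∈ A' := ⟨hyA, x, hxy⟩
      refine ⟨y, hyA', ?_⟩
      have := hlip _ _ _ _ (hf y hyA') hxy
      rw [dist_self] at this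
      exact dist_le_zero.mp this
    refine measure_mono_null hsub ?_
    have h0 : μH[((n - 1 : ℕ) : ℝ)] A' = 0 :=
      measure_mono_null (fun y hy => hy.1) (hausdorff_codimTwo_null q.1 q.2.1 q.2.2.1 q.2.2.2 hq)
    have := hfl.hausdorffMeasure_image_le (d := ((n - 1 : ℕ) : ℝ)) (by positivity)
    rw [h0] at this
    simpa using this
  let D : ℕ → Q := TopologicalSpace.denseSeq Q
  have hcover : {x : Eucl n | ∃ u v : USphere n, u ≠ v ∧
      x ∈ faceIn K (u : Eucl n) ∧ x ∈ faceIn K (v : Eucl n)} ⊆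
      ⋃ i ∈ {i : ℕ | LinearIndependent ℝ ![(D i).1, (D i).2.1]}, P (D i) := by
    rintro x ⟨⟨u, hu⟩, ⟨v, hv⟩, huv, hxu, hxv⟩
    simp only [mem_sphere_iff_norm, sub_zero] at hu hv
    have huv' : u ≠ v := fun h => huv (Subtype.ext h)
    rw [hK.mem_faceIn] at hxu hxv
    dsimp only at hxu hxv
    have huu : inner ℝ u u = (1 : ℝ) := by rw [real_inner_self_eq_norm_sq, hu]; norm_num
    have hvv : inner ℝ v v = (1 : ℝ) := by rw [real_inner_self_eq_norm_sq, hv]; norm_num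
    have hvu : inner ℝ v u = inner ℝ u v := real_inner_comm _ _
    -- the two normals are not opposite
    have hopp : u + v ≠ 0 := by
      intro h0
      have hv' : v = -u := (neg_eq_of_add_eq_zero_right h0).symm
      obtain ⟨p, hp⟩ := hK.interior_nonempty
      have hconst : ∀ z ∈ K, inner ℝ z u = inner ℝ x u := by
        intro z hz
        have h1 := hxu.2 z hz
        have h2 := hxv.2 z hz
        rw [hv', inner_neg_right, inner_neg_right] at h2
        linarith
      obtain ⟨ε, hε, hball⟩ := Metric.mem_nhds_iff.mp (mem_interior_iff_mem_nhds.mp hp)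
      have hp2 : p + (ε / 2) • u ∈ K := by
        apply hball
        rw [Metric.mem_ball, dist_eq_norm, add_sub_cancel_left, norm_smul, hu,
          Real.norm_of_nonneg (by positivity)]
        linarith
      have e1 := hconst _ hp2
      have e2 := hconst p (interior_subset hp)
      rw [inner_add_left, inner_smul_left, huu] at e1
      simp at e1
      linarith
    have hc1 : inner ℝ u v < (1 : ℝ) := by
      have : 0 < ‖u - v‖ ^ 2 := by
        have := norm_pos_iff.mpr (sub_ne_zero.mpr huv'); positivity
      rw [norm_sub_sq_real, hu, hv] at this
      linarith
    have hc2 : -1 < inner ℝ u v := by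
      have : 0 < ‖u + v‖ ^ 2 := by
        have := norm_pos_iff.mpr hopp; positivity
      rw [norm_add_sq_real, hu, hv] at this
      linarith
    let det : Q → ℝ := fun q =>
      inner ℝ q.1 u * inner ℝ q.2.1 v - inner ℝ q.1 v * inner ℝ q.2.1 u
    let sd : Q → ℝ := fun q =>
      (q.2.2.1 - inner ℝ q.1 x) * inner ℝ q.2.1 v - (q.2.2.2 - inner ℝ q.2.1 x) * inner ℝ q.1 v
    let td : Q → ℝ := fun q =>
      (q.2.2.2 - inner ℝ q.2.1 x) * inner ℝ q.1 u - (q.2.2.1 - inner ℝ q.1 x) * inner ℝ q.2.1 u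
    have hdc : Continuous det := by fun_prop
    have hsc : Continuous sd := by fun_prop
    have htc : Continuous td := by fun_prop
    have hopen : IsOpen {q : Q | 0 < det q ∧ 0 < sd q ∧ 0 < td q} :=
      (isOpen_lt continuous_const hdc).inter
        ((isOpen_lt continuous_const hsc).inter (isOpen_lt continuous_const htc))
    have hne : {q : Q | 0 < det q ∧ 0 < sd q ∧ 0 < td q}.Nonempty := by
      refine ⟨(u, v, inner ℝ u (x + u + v), inner ℝ v (x + u + v)), ?_, ?_, ?_⟩
      · simp only [det, huu, hvv, hvu]; nlinarith
      · simp only [sd, inner_add_right, huu, hvv, hvu]; nlinarith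
      · simp only [td, inner_add_right, huu, hvv, hvu]; nlinarith
    obtain ⟨i, hi⟩ := (TopologicalSpace.denseRange_denseSeq Q).exists_mem_open hopen hne
    change 0 < det (D i) ∧ 0 < sd (D i) ∧ 0 < td (D i) at hi
    obtain ⟨hd, hs, ht⟩ := hi
    simp only [Set.mem_iUnion]
    refine ⟨i, ?_, ?_⟩
    · change LinearIndependent ℝ ![(D i).1, (D i).2.1]
      rw [LinearIndependent.pair_iff]
      intro s t hst
      have e1 : s * inner ℝ (D i).1 u + t * inner ℝ (D i).2.1 u = (0 : ℝ) := by
        have := congrArg (fun w => (inner ℝ w u : ℝ)) hst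
        simpa [inner_add_left, inner_smul_left] using this
      have e2 : s * inner ℝ (D i).1 v + t * inner ℝ (D i).2.1 v = (0 : ℝ) := by
        have := congrArg (fun w => (inner ℝ w v : ℝ)) hst
        simpa [inner_add_left, inner_smul_left] using this
      have hs0 : s * det (D i) = 0 := by
        simp only [det]
        linear_combination (inner ℝ (D i).2.1 v) * e1 - (inner ℝ (D i).2.1 u) * e2
      have ht0 : t * det (D i) = 0 := by
        simp only [det]
        linear_combination (inner ℝ (D i).1 u) * e2 - (inner ℝ (D i).1 v) * e1
      exact ⟨(mul_eq_zero.mp hs0).resolve_right hd.ne', (mul_eq_zero.mp ht0).resolve_right hd.ne'⟩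
    · refine ⟨x + (sd (D i) / det (D i)) • u + (td (D i) / det (D i)) • v, ⟨?_, ?_⟩, hxu.1, ?_⟩
      · rw [inner_add_right, inner_add_right, inner_smul_right, inner_smul_right]
        have := hd.ne'
        field_simp
        simp only [det, sd, td]
        ring
      · rw [inner_add_right, inner_add_right, inner_smul_right, inner_smul_right]
        have := hd.ne'
        field_simp
        simp only [det, sd, td]
        ring
      · intro z hz
        have e : x + (sd (D i) / det (D i)) • u + (td (D i) / det (D i)) • v - x =
            (sd (D i) / det (D i)) • u + (td (D i) / det (D i)) • v := by abel
        rw [e, inner_add_right, inner_smul_right, inner_smul_right, inner_sub_left, inner_sub_left]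
        have h1 := hxu.2 z hz
        have h2 := hxv.2 z hz
        have h3 : 0 < sd (D i) / det (D i) := by positivity
        have h4 : 0 < td (D i) / det (D i) := by positivity
        nlinarith
  have hnull : μH[((n - 1 : ℕ) : ℝ)] {x : Eucl n | ∃ u v : USphere n, u ≠ v ∧
      x ∈ faceIn K (u : Eucl n) ∧ x ∈ faceIn K (v : Eucl n)} = 0 := by
    refine measure_mono_null hcover ?_
    rw [measure_biUnion_null_iff (Set.to_countable _)]
    exact fun i hi => hPnull (D i) hi
  rw [euclideanHausdorffMeasure_def, Measure.smul_apply, hnull, smul_zero]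

/-- The inverse spherical image of a closed set of directions is compact. -/
theorem IsBody.isCompact_invSphericalImage {n : ℕ} {K : Set (Eucl n)} (hK : IsBody K)
    {C : Set (USphere n)} (hC : IsClosed C) : IsCompact (invSphericalImage K C) := by
  have hcl : IsClosed {p : Eucl n × USphere n |
      ∀ y ∈ K, (inner ℝ y (p.2 : Eucl n) : ℝ) ≤ inner ℝ p.1 (p.2 : Eucl n)} := by
    have : {p : Eucl n × USphere n |
        ∀ y ∈ K, (inner ℝ y (p.2 : Eucl n) : ℝ) ≤ inner ℝ p.1 (p.2 : Eucl n)} =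
        ⋂ y ∈ K, {p : Eucl n × USphere n |
          (inner ℝ y (p.2 : Eucl n) : ℝ) ≤ inner ℝ p.1 (p.2 : Eucl n)} := by
      ext p; simp
    rw [this]
    exact isClosed_biInter fun y _ => isClosed_le (by fun_prop) (by fun_prop)
  have hcomp : IsCompact ((K ×ˢ C) ∩ {p : Eucl n × USphere n |
      ∀ y ∈ K, (inner ℝ y (p.2 : Eucl n) : ℝ) ≤ inner ℝ p.1 (p.2 : Eucl n)}) :=
    (hK.isCompact.prod hC.isCompact).inter_right hcl
  have himg : invSphericalImage K C = Prod.fst '' ((K ×ˢ C) ∩ {p : Eucl n × USphere n |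
      ∀ y ∈ K, (inner ℝ y (p.2 : Eucl n) : ℝ) ≤ inner ℝ p.1 (p.2 : Eucl n)}) := by
    ext x
    simp only [invSphericalImage, Set.mem_iUnion, hK.mem_faceIn]
    constructor
    · rintro ⟨u, hu, hx, h⟩
      exact ⟨(x, u), ⟨⟨hx, hu⟩, h⟩, rfl⟩
    · rintro ⟨⟨x', u⟩, ⟨⟨hx, hu⟩, h⟩, rfl⟩
      exact ⟨u, hu, hx, h⟩
  rw [himg]
  exact hcomp.image continuous_fst

/-- Borel sets are measurable for the set function `B ↦ ℋⁿ⁻¹(τ(K, B))`. -/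
theorem IsBody.borel_le_caratheodory {n : ℕ} {K : Set (Eucl n)} (hK : IsBody K) :
    (inferInstance : MeasurableSpace (USphere n)) ≤ (surfaceOuter K).caratheodory := by
  rw [BorelSpace.measurable_eq (α := USphere n), borel_eq_generateFrom_isClosed]
  refine MeasurableSpace.generateFrom_le fun C hC => ?_
  rw [OuterMeasure.isCaratheodory_iff_le]
  intro T
  change μHE[n - 1] (invSphericalImage K (T ∩ C)) + μHE[n - 1] (invSphericalImage K (T \ C)) ≤
    μHE[n - 1] (invSphericalImage K T)
  have hm : MeasurableSet (invSphericalImage K C) :=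
    (hK.isCompact_invSphericalImage hC).isClosed.measurableSet
  rw [← measure_inter_add_sdiff (invSphericalImage K T) hm]
  refine add_le_add (measure_mono ?_) ?_
  · exact Set.subset_inter (Set.biUnion_subset_biUnion_left Set.inter_subset_left)
      (Set.biUnion_subset_biUnion_left Set.inter_subset_right)
  · refine le_trans (measure_mono (t := (invSphericalImage K T \ invSphericalImage K C) ∪
      {x : Eucl n | ∃ u v : USphere n, u ≠ v ∧
        x ∈ faceIn K (u : Eucl n) ∧ x ∈ faceIn K (v : Eucl n)}) ?_) ?_
    · intro x hx
      simp only [invSphericalImage, Set.mem_iUnion] at hx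
      obtain ⟨u, ⟨huT, huC⟩, hxu⟩ := hx
      by_cases hxC : x ∈ invSphericalImage K C
      · right
        simp only [invSphericalImage, Set.mem_iUnion] at hxC
        obtain ⟨v, hvC, hxv⟩ := hxC
        exact ⟨u, v, fun h => huC (h ▸ hvC), hxu, hxv⟩
      · left
        refine ⟨?_, hxC⟩
        simp only [invSphericalImage, Set.mem_iUnion]
        exact ⟨u, huT, hxu⟩
    · refine le_trans (measure_union_le _ _) ?_
      rw [hK.singular_null, add_zero]

/-- The surface area measure `S_K` of a convex body `K`: the Borel measure on the sphere with
`S_K(B) = ℋⁿ⁻¹(τ(K, B))`. -/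
noncomputable def surfaceAreaMeasure {n : ℕ} (K : Set (Eucl n)) (hK : IsBody K) :
    Measure (USphere n) :=
  (surfaceOuter K).toMeasure hK.borel_le_caratheodory

theorem surfaceAreaMeasure_apply {n : ℕ} {K : Set (Eucl n)} (hK : IsBody K)
    {B : Set (USphere n)} (hB : MeasurableSet B) :
    surfaceAreaMeasure K hK B = μHE[n - 1] (invSphericalImage K B) :=
  toMeasure_apply _ hK.borel_le_caratheodory hB

/-- `L` is homothetic to `K`: `L = x + tK` for some `t > 0` and `x ∈ ℝⁿ`. -/
def AreHomothetic {n : ℕ} (K L : Set (Eucl n)) : Prop :=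
  ∃ t : ℝ, 0 < t ∧ ∃ x : Eucl n, L = {x} + t • K

/-- A convex body `K` is weakly decomposable if there is a convex body `L`, not homothetic to `K`,
with `supp S_{K+L} ⊆ supp S_K`. -/
def IsWeaklyDecomposable {n : ℕ} (K : Set (Eucl n)) : Prop :=
  ∃ (hK : IsBody K) (L : Set (Eucl n)) (hL : IsBody L), ¬ AreHomothetic K L ∧
    (surfaceAreaMeasure (K + L) (hK.add hL)).support ⊆ (surfaceAreaMeasure K hK).support

/-- A full-dimensional polytope in `ℝⁿ`: the convex hull of a finite set, with non-empty
interior. -/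
def IsFullPolytope {n : ℕ} (P : Set (Eucl n)) : Prop :=
  (∃ V : Set (Eucl n), V.Finite ∧ P = convexHull ℝ V) ∧ (interior P).Nonempty

/-- An `n`-simplex in `ℝⁿ`: the convex hull of `n + 1` affinely independent points. -/
def IsNSimplex {n : ℕ} (P : Set (Eucl n)) : Prop :=
  ∃ v : Fin (n + 1) → Eucl n, AffineIndependent ℝ v ∧ P = convexHull ℝ (Set.range v)

/-- The mixed volume `V(K₁, …, Kₙ)` of compact convex sets, by the polarization formula
`n! V(K₁, …, Kₙ) = ∑_J (-1)^(n-|J|) Volₙ(∑_{j ∈ J} K_j)`. -/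
noncomputable def mixedVolume {n : ℕ} (K : Fin n → Set (Eucl n)) : ℝ :=
  (1 / (n.factorial : ℝ)) * ∑ J : Finset (Fin n),
    (-1 : ℝ) ^ (n - J.card) * (volume (∑ j ∈ J, K j)).toReal

/-- `V(A, B, K[n-2])` (for `n ≥ 2`). -/
noncomputable def mixedVolume₂ {n : ℕ} (A B K : Set (Eucl n)) : ℝ :=
  mixedVolume fun i : Fin n => if i.val = 0 then A else if i.val = 1 then B else K

/-- The Bezout constant `b₂(K)` (for `n ≥ 2`), the supremum of
`V(A, B, K[n-2]) V(K) / (V(A, K[n-1]) V(B, K[n-1]))` over all pairs of convex bodies `A`, `B`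
containing the origin in their interiors. -/
noncomputable def bezoutConst₂ {n : ℕ} (K : Set (Eucl n)) : EReal :=
  sSup {r : EReal | ∃ A B : Set (Eucl n), (IsBody A ∧ 0 ∈ interior A) ∧
    (IsBody B ∧ 0 ∈ interior B) ∧
    r = ((mixedVolume₂ A B K * (volume K).toReal /
      (mixedVolume₂ A K K * mixedVolume₂ B K K) : ℝ) : EReal)}

/-! A body is determined by its supporting half-spaces with normals in `supp S_K`
(`IsBody.mem_of_forall_support`), so `supp S_K` lies in a closed set `C` exactly when every boundary
point has an outer normal in `C`. This turns the condition on `S_{K+L}` into a statement about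
normals at boundary points.

For a polytope that is not a simplex, some vertex `v` lies in the affine span of the others. Take
`u` in the support with `v` off the face `P^u`, and let `L` be `P` cut slightly below that face. The
cut adds no normal to `P + L` that is needed beyond `supp S_P`. A homothety from `P` onto a proper
truncation leaves at most one vertex in place, so all vertices but `v` would lie in `P^u`, and then
so would `v` by the affine dependence.

For a simplex, the support consists of facet normals only. If `P + L` has no others, cancelling `P`
shows that `L` is cut out by lower bounds on the barycentric coordinates, hence is a translated
dilate of `P`. The statement on `b₂` is the first part specialised to polytopes. -/

/-! ### Support functions, outer normals and exit points -/

theorem IsBody.le_supportFun {n : ℕ} {K : Set (Eucl n)} (hK : IsBody K) {x : Eucl n} (hx : x ∈ K)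
    (u : Eucl n) : inner ℝ x u ≤ supportFun K u :=
  le_csSup (hK.isCompact.image (by fun_prop)).bddAbove ⟨x, hx, rfl⟩

theorem IsBody.continuous_supportFun {n : ℕ} {K : Set (Eucl n)} (hK : IsBody K) :
    Continuous (supportFun K) :=
  hK.isCompact.continuous_sSup (f := fun u y : Eucl n => inner ℝ y u)
    (show Continuous fun p : Eucl n × Eucl n => inner ℝ p.2 p.1 by fun_prop)

/-- A non-zero vector is a positive multiple of a point of the unit sphere. -/
theorem exists_sphere_smul {n : ℕ} {w : Eucl n} (hw : w ≠ 0) :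
    ∃ (u : USphere n) (r : ℝ), 0 < r ∧ w = r • (u : Eucl n) := by
  have h := norm_pos_iff.mpr hw
  refine ⟨⟨‖w‖⁻¹ • w, ?_⟩, ‖w‖, h, ?_⟩
  · simp [norm_smul, inv_mul_cancel₀ h.ne']
  · simp [smul_smul, mul_inv_cancel₀ h.ne']

/-- A point of a convex body outside the interior has a unit outer normal, and interior points lie
strictly on the inner side. -/
theorem IsBody.exists_normal {n : ℕ} {K : Set (Eucl n)} (hK : IsBody K) {y : Eucl n}
    (hy : y ∈ K) (hyi : y ∉ interior K) :
    ∃ u : USphere n, y ∈ faceIn K (u : Eucl n) ∧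
      ∀ b ∈ interior K, inner ℝ b (u : Eucl n) < inner ℝ y (u : Eucl n) := by
  obtain ⟨f, hf⟩ := geometric_hahn_banach_open_point hK.convex.interior isOpen_interior hyi
  set w := (InnerProductSpace.toDual ℝ (Eucl n)).symm f with hw
  have hfw : ∀ z, f z = inner ℝ z w := by
    intro z
    rw [real_inner_comm, hw, InnerProductSpace.toDual_symm_apply]
  have hw0 : w ≠ 0 := by
    intro h0
    obtain ⟨b, hb⟩ := hK.interior_nonempty
    have := hf b hb
    rw [hfw, hfw, h0, inner_zero_right, inner_zero_right] at this
    exact lt_irrefl _ this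
  obtain ⟨u, r, hr, hwu⟩ := exists_sphere_smul hw0
  have hlt : ∀ b ∈ interior K, inner ℝ b (u : Eucl n) < inner ℝ y (u : Eucl n) := by
    intro b hb
    have := hf b hb
    rw [hfw, hfw, hwu, inner_smul_right, inner_smul_right] at this
    exact lt_of_mul_lt_mul_left this hr.le
  refine ⟨u, hK.mem_faceIn.mpr ⟨hy, fun z hz => ?_⟩, hlt⟩
  -- Separation only controls the interior; the body is contained in its closure.
  have hzc : z ∈ closure (interior K) := by
    rw [hK.convex.closure_interior_eq_closure_of_nonempty_interior hK.interior_nonempty]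
    exact subset_closure hz
  have hcl : IsClosed {z : Eucl n | inner ℝ z (u : Eucl n) ≤ inner ℝ y (u : Eucl n)} :=
    isClosed_le (by fun_prop) (by fun_prop)
  exact hcl.closure_subset_iff.mpr (fun b hb => (hlt b hb).le) hzc

/-- Points in a face in a unit direction are not interior. -/
theorem IsBody.notMem_interior_of_mem_faceIn {n : ℕ} {K : Set (Eucl n)} (hK : IsBody K)
    {y : Eucl n} {u : USphere n} (hy : y ∈ faceIn K (u : Eucl n)) : y ∉ interior K := by
  intro hyi
  obtain ⟨ε, hε, hball⟩ := Metric.mem_nhds_iff.mp (mem_interior_iff_mem_nhds.mp hyi)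
  have hu : ‖(u : Eucl n)‖ = 1 := by simp
  have h := (hK.mem_faceIn.mp hy).2 (y + (ε / 2) • (u : Eucl n)) (hball (by
    rw [Metric.mem_ball, dist_eq_norm, add_sub_cancel_left, norm_smul, hu,
      Real.norm_of_nonneg (by positivity)]
    linarith))
  rw [inner_add_left, real_inner_smul_left, real_inner_self_eq_norm_sq, hu] at h
  linarith

/-- A segment from the interior of a convex body to its complement leaves the body at a point with
a unit outer normal that separates the end point of the segment from the body. -/
theorem IsBody.exists_exit {n : ℕ} {K : Set (Eucl n)} (hK : IsBody K) {b e : Eucl n}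
    (hb : b ∈ interior K) (hbe : b + e ∉ K) :
    ∃ (s : ℝ) (u : USphere n), b + s • e ∈ faceIn K (u : Eucl n) ∧
      supportFun K (u : Eucl n) < inner ℝ (b + e) (u : Eucl n) := by
  set S : Set ℝ := Icc 0 1 ∩ (fun s : ℝ => b + s • e) ⁻¹' K with hS
  have hSc : IsCompact S := isCompact_Icc.inter_right (hK.isCompact.isClosed.preimage (by fun_prop))
  obtain ⟨s, ⟨⟨hs0, hs1⟩, hsK⟩, hmax⟩ :=
    hSc.exists_isGreatest ⟨0, ⟨le_rfl, zero_le_one⟩, by simpa using interior_subset hb⟩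
  have hs1' : s < 1 := lt_of_le_of_ne hs1 (by rintro rfl; exact hbe (by simpa using hsK))
  have hni : b + s • e ∉ interior K := by
    intro hi
    have hev : ∀ᶠ r in nhds s, b + r • e ∈ K ∧ r < 1 :=
      (ContinuousAt.eventually_mem (f := fun r : ℝ => b + r • e) (by fun_prop)
        (mem_interior_iff_mem_nhds.mp hi)).and (eventually_lt_nhds hs1')
    obtain ⟨ε, hε, hball⟩ := Metric.eventually_nhds_iff.mp hev
    obtain ⟨hr1, hr2⟩ := hball (y := s + ε / 2) (by
      rw [Real.dist_eq, add_sub_cancel_left, abs_of_pos (by positivity)]; linarith)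
    have := hmax ⟨⟨by linarith, hr2.le⟩, hr1⟩
    linarith
  obtain ⟨u, hu, hlt⟩ := hK.exists_normal hsK hni
  refine ⟨s, u, hu, ?_⟩
  have h1 := hlt b hb
  rw [← hu.2]
  simp only [inner_add_left, real_inner_smul_left] at h1 ⊢
  -- Going from `b` to the exit point strictly increases the `u`-component, so `e` points outward;
  -- as `s < 1`, the rest of the segment increases it further.
  have : 0 < inner ℝ e (u : Eucl n) := by
    by_contra hcon
    push Not at hcon
    nlinarith
  nlinarith

/-! ### The support of the surface area measure determines the body -/

/-- A set whose orthogonal projection along `e` covers a ball is not `ℋⁿ⁻¹`-null. -/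
theorem euclideanHausdorffMeasure_ne_zero_of_projection {n : ℕ} {e : Eucl n} (he : e ≠ 0)
    {E : Set (Eucl n)} (t₀ : (ℝ ∙ e)ᗮ) {r : ℝ} (hr : 0 < r)
    (hE : ∀ t ∈ Metric.ball t₀ r, ∃ y ∈ E, (ℝ ∙ e)ᗮ.orthogonalProjectionOnto y = t) :
    μHE[n - 1] E ≠ 0 := by
  intro h0
  have hfin : Module.finrank ℝ (ℝ ∙ e)ᗮ = n - 1 := by
    have h := Submodule.finrank_add_finrank_orthogonal (ℝ ∙ e)
    rw [finrank_span_singleton he, finrank_euclideanSpace_fin] at h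
    omega
  -- A 1-Lipschitz map sends null sets to null sets, whereas a ball in the `(n-1)`-dimensional
  -- complement has positive volume.
  have hlip : LipschitzWith 1 (ℝ ∙ e)ᗮ.orthogonalProjectionOnto :=
    LipschitzWith.of_dist_le_mul fun x y => by
      rw [dist_eq_norm, dist_eq_norm, ← map_sub, NNReal.coe_one, one_mul]
      exact Submodule.norm_orthogonalProjectionOnto_apply_le _ _
  have hE0 : μH[((n - 1 : ℕ) : ℝ)] E = 0 := by
    rw [euclideanHausdorffMeasure_def, Measure.smul_apply, ENNReal.smul_def, smul_eq_mul,
      mul_eq_zero] at h0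
    exact h0.resolve_left (by
      simpa using addHaarScalarFactor_volume_hausdorffMeasure_ne_zero (n - 1))
  have him := hlip.hausdorffMeasure_image_le (d := ((n - 1 : ℕ) : ℝ)) (by positivity) E
  rw [hE0, mul_zero, nonpos_iff_eq_zero] at him
  have hball : μH[((n - 1 : ℕ) : ℝ)] (Metric.ball t₀ r) = 0 := measure_mono_null hE him
  have hvol : (volume : Measure (ℝ ∙ e)ᗮ) (Metric.ball t₀ r) = 0 := by
    rw [← InnerProductSpace.euclideanHausdorffMeasure_eq_volume, hfin,
      euclideanHausdorffMeasure_def, Measure.smul_apply, hball, smul_zero]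
  exact (Metric.measure_ball_pos volume t₀ hr).ne' hvol

/-- A convex body is the intersection of its supporting half-spaces with outer normals in the
support of its surface area measure. -/
theorem IsBody.mem_of_forall_support {n : ℕ} {K : Set (Eucl n)} (hK : IsBody K) {x : Eucl n}
    (hx : ∀ u ∈ (surfaceAreaMeasure K hK).support,
      inner ℝ x (u : Eucl n) ≤ supportFun K (u : Eucl n)) : x ∈ K := by
  by_contra hxK
  obtain ⟨q, hq⟩ := hK.interior_nonempty
  obtain ⟨ρ, hρ, hqρ⟩ := Metric.mem_nhds_iff.mp (mem_interior_iff_mem_nhds.mp hq)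
  -- Moving `x` slightly towards the inner point `q` stays outside `K` but makes the inequalities
  -- for support normals strict, with uniform slack `s * ρ / 2`.
  obtain ⟨s, hs0, hs1, hsK⟩ : ∃ s : ℝ, 0 < s ∧ s < 1 ∧ x + s • (q - x) ∉ K := by
    have hev : ∀ᶠ s in nhds (0 : ℝ), x + s • (q - x) ∈ Kᶜ ∧ s < 1 :=
      (ContinuousAt.eventually_mem (f := fun s : ℝ => x + s • (q - x)) (by fun_prop)
        (hK.isCompact.isClosed.isOpen_compl.mem_nhds (by simpa using hxK))).and
        (eventually_lt_nhds zero_lt_one)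
    obtain ⟨ε, hε, hball⟩ := Metric.eventually_nhds_iff.mp hev
    obtain ⟨h1, h2⟩ := hball (y := ε / 2) (by
      rw [Real.dist_eq, sub_zero, abs_of_pos (by positivity)]; linarith)
    exact ⟨ε / 2, by positivity, h2, h1⟩
  set x' := x + s • (q - x) with hx'
  obtain ⟨δ, hδ, hδK⟩ := Metric.isOpen_iff.mp hK.isCompact.isClosed.isOpen_compl x' hsK
  obtain ⟨r₀, hr₀, hr₀K⟩ := Metric.isOpen_iff.mp isOpen_interior q hq
  -- A shift by less than `r` keeps `q` in the interior, keeps `x'` outside `K`, and does not use up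
  -- the slack.
  set r := min r₀ (min δ (s * ρ / 2)) with hr
  have hrpos : 0 < r := lt_min hr₀ (lt_min hδ (by positivity))
  have hrs : r ≤ s * ρ / 2 := (min_le_right _ _).trans (min_le_right _ _)
  set e := x' - q with he
  have he0 : e ≠ 0 := by
    intro h0
    exact hsK (by rw [sub_eq_zero.mp h0]; exact interior_subset hq)
  -- The segments parallel to `e` leave `K` at points whose normals separate the shifted `x'` from
  -- `K`; by the slack these normals are off the support. The exit points project onto a ball, yet
  -- they lie in a null set.
  have hmain := euclideanHausdorffMeasure_ne_zero_of_projection he0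
    (E := invSphericalImage K (surfaceAreaMeasure K hK).supportᶜ)
    ((ℝ ∙ e)ᗮ.orthogonalProjectionOnto q) hrpos ?_
  · apply hmain
    rw [← surfaceAreaMeasure_apply hK isOpen_compl_support.measurableSet]
    exact measure_compl_support
  intro t ht
  set d : Eucl n := ((t - (ℝ ∙ e)ᗮ.orthogonalProjectionOnto q : (ℝ ∙ e)ᗮ) : Eucl n) with hd
  have hdr : ‖d‖ < r := by
    rw [Metric.mem_ball, dist_eq_norm] at ht
    exact ht
  have hb : q + d ∈ interior K := hr₀K (by
    rw [Metric.mem_ball, dist_eq_norm, add_sub_cancel_left]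
    exact hdr.trans_le (min_le_left _ _))
  have hbe' : q + d + e = x' + d := by rw [he]; abel
  have hbe : q + d + e ∉ K := by
    rw [hbe']
    apply hδK
    rw [Metric.mem_ball, dist_eq_norm, add_sub_cancel_left]
    exact hdr.trans_le ((min_le_right _ _).trans (min_le_left _ _))
  obtain ⟨τ, v, hv, hlt⟩ := hK.exists_exit hb hbe
  refine ⟨q + d + τ • e, ?_, ?_⟩
  · simp only [invSphericalImage, Set.mem_iUnion]
    refine ⟨v, fun hvs => ?_, hv⟩
    have hv1 : ‖(v : Eucl n)‖ = 1 := by simp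
    have h1 := hx v hvs
    have h2 := hK.le_supportFun (hqρ (show q + (ρ / 2) • (v : Eucl n) ∈ Metric.ball q ρ by
      rw [Metric.mem_ball, dist_eq_norm, add_sub_cancel_left, norm_smul, hv1,
        Real.norm_of_nonneg (by positivity)]
      linarith)) (v : Eucl n)
    rw [inner_add_left, real_inner_smul_left, real_inner_self_eq_norm_sq, hv1] at h2
    have h3 := real_inner_le_norm d (v : Eucl n)
    rw [hv1, mul_one] at h3
    rw [hbe', hx'] at hlt
    simp only [inner_add_left, real_inner_smul_left, inner_sub_left] at hlt
    nlinarith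
  · have hpe : (ℝ ∙ e)ᗮ.orthogonalProjectionOnto e = 0 := by
      rw [Submodule.orthogonalProjectionOnto_eq_zero_iff, Submodule.orthogonal_orthogonal]
      exact Submodule.mem_span_singleton_self e
    rw [map_add, map_add, map_smul, hpe, hd,
      Submodule.orthogonalProjectionOnto_mem_subspace_eq_self]
    simp

/-- Every boundary point of a convex body has an outer normal in the support of the surface area
measure. -/
theorem IsBody.exists_mem_support_of_mem_faceIn {n : ℕ} {K : Set (Eucl n)} (hK : IsBody K)
    {x : Eucl n} {w : USphere n} (hx : x ∈ faceIn K (w : Eucl n)) :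
    ∃ u ∈ (surfaceAreaMeasure K hK).support, x ∈ faceIn K (u : Eucl n) := by
  by_contra! hcon
  set C := (surfaceAreaMeasure K hK).support with hC
  -- Compactness of the support makes the gap uniform, so a whole `δ`-ball around `x` satisfies
  -- every defining inequality and `x` would be interior.
  have hgap : ∃ δ > 0, ∀ u ∈ C, inner ℝ x (u : Eucl n) + δ ≤ supportFun K (u : Eucl n) := by
    rcases C.eq_empty_or_nonempty with h0 | hne
    · exact ⟨1, one_pos, by simp [h0]⟩
    have hCc : IsCompact C := isClosed_support.isCompact
    obtain ⟨u₀, hu₀, hmin⟩ := hCc.exists_isMinOn hne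
      (f := fun u : USphere n => supportFun K (u : Eucl n) - inner ℝ x (u : Eucl n))
      ((hK.continuous_supportFun.comp continuous_subtype_val).sub
        (by fun_prop)).continuousOn
    refine ⟨supportFun K (u₀ : Eucl n) - inner ℝ x (u₀ : Eucl n), ?_, fun u hu => ?_⟩
    · have h1 := hK.le_supportFun hx.1 (u₀ : Eucl n)
      have h2 : inner ℝ x (u₀ : Eucl n) ≠ supportFun K (u₀ : Eucl n) :=
        fun h => hcon u₀ hu₀ ⟨hx.1, h⟩
      exact sub_pos.mpr (lt_of_le_of_ne h1 h2)
    · have := hmin hu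
      simp only [mem_ofPred_eq] at this
      linarith
  obtain ⟨δ, hδ, hgap⟩ := hgap
  refine hK.notMem_interior_of_mem_faceIn hx (mem_interior_iff_mem_nhds.mpr
    (Metric.mem_nhds_iff.mpr ⟨δ, hδ, fun z hz => hK.mem_of_forall_support fun u hu => ?_⟩))
  rw [Metric.mem_ball, dist_eq_norm] at hz
  have h1 := real_inner_le_norm (z - x) (u : Eucl n)
  have hu1 : ‖(u : Eucl n)‖ = 1 := by simp
  rw [hu1, mul_one, inner_sub_left] at h1
  have := hgap u hu
  linarith

/-- If every boundary point has an outer normal in the closed set `C`, then the surface area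
measure is supported in `C`. -/
theorem IsBody.support_subset_of_forall_mem_faceIn {n : ℕ} {K : Set (Eucl n)} (hK : IsBody K)
    {C : Set (USphere n)} (hC : IsClosed C)
    (h : ∀ (w : USphere n), ∀ x ∈ faceIn K (w : Eucl n), ∃ u ∈ C, x ∈ faceIn K (u : Eucl n)) :
    (surfaceAreaMeasure K hK).support ⊆ C := by
  refine support_subset_of_isClosed hC ?_
  rw [mem_ae_iff, surfaceAreaMeasure_apply hK hC.isOpen_compl.measurableSet]
  -- A point with a normal outside `C` also has one inside, hence two distinct normals; such points
  -- are negligible.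
  refine measure_mono_null (fun x hx => ?_) hK.singular_null
  simp only [invSphericalImage, Set.mem_iUnion] at hx
  obtain ⟨v, hv, hxv⟩ := hx
  obtain ⟨u, hu, hxu⟩ := h v x hxv
  exact ⟨u, v, fun huv => hv (huv ▸ hu), hxu, hxv⟩

/-! ### Vertices and faces of polytopes -/

/-- A face of a polytope is the convex hull of the vertices that it contains. -/
theorem mem_convexHull_filter_inner_eq {n : ℕ} {W : Finset (Eucl n)} {x u : Eucl n} {m : ℝ}
    (hx : x ∈ convexHull ℝ (W : Set (Eucl n))) (hW : ∀ w ∈ W, inner ℝ w u ≤ m)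
    (hm : m ≤ inner ℝ x u) :
    x ∈ convexHull ℝ {w : Eucl n | w ∈ W ∧ inner ℝ w u = m} := by
  classical
  obtain ⟨α, hα, hα1, rfl⟩ := Finset.mem_convexHull'.mp hx
  -- Complementary slackness: these nonnegative terms have nonpositive sum.
  have hzero : ∀ w ∈ W, α w * (m - inner ℝ w u) = 0 := by
    have hsum : ∑ w ∈ W, α w * (m - inner ℝ w u) ≤ 0 := by
      simp only [mul_sub, Finset.sum_sub_distrib, ← Finset.sum_mul, hα1]
      simp only [sum_inner, real_inner_smul_left] at hm
      linarith
    have hnn : ∀ w ∈ W, 0 ≤ α w * (m - inner ℝ w u) := fun w hw =>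
      mul_nonneg (hα w hw) (sub_nonneg.mpr (hW w hw))
    exact (Finset.sum_eq_zero_iff_of_nonneg hnn).mp (le_antisymm hsum (Finset.sum_nonneg hnn))
  have hfilter : ∀ w ∈ W, α w ≠ 0 → inner ℝ w u = m := fun w hw h =>
    (sub_eq_zero.mp ((mul_eq_zero.mp (hzero w hw)).resolve_left h)).symm
  rw [← Finset.sum_filter_of_ne (p := fun w => inner ℝ w u = m)
    (fun w hw h => hfilter w hw fun h0 => h (by rw [h0, zero_smul]))]
  refine (convex_convexHull ℝ _).sum_mem (fun w hw => hα w (Finset.mem_filter.mp hw).1) ?_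
    (fun w hw => subset_convexHull ℝ _ (Finset.mem_filter.mp hw))
  rw [Finset.sum_filter_of_ne hfilter, hα1]

/-- A point outside the convex hull of a finite set is strictly separated from it. -/
theorem exists_inner_lt_of_notMem_convexHull {n : ℕ} {S : Set (Eucl n)} (hS : S.Finite)
    {v : Eucl n} (hv : v ∉ convexHull ℝ S) :
    ∃ u : Eucl n, ∀ w ∈ S, inner ℝ w u < inner ℝ v u := by
  obtain ⟨f, c, hfv, hfS⟩ :=
    geometric_hahn_banach_point_closed (convex_convexHull ℝ S) (hS.isCompact_convexHull (𝕜 := ℝ)).isClosed hv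
  refine ⟨-(InnerProductSpace.toDual ℝ (Eucl n)).symm f, fun w hw => ?_⟩
  have h := hfv.trans (hfS w (subset_convexHull ℝ S hw))
  have hf : ∀ z, f z = inner ℝ z ((InnerProductSpace.toDual ℝ (Eucl n)).symm f) := fun z => by
    rw [real_inner_comm, InnerProductSpace.toDual_symm_apply]
  rw [inner_neg_right, inner_neg_right, ← hf, ← hf]
  linarith

/-- A polytope is the convex hull of a finite set of points in convex position. -/
theorem exists_finset_convexHull_eq {n : ℕ} {V : Set (Eucl n)} (hV : V.Finite) :
    ∃ W : Finset (Eucl n), convexHull ℝ (W : Set (Eucl n)) = convexHull ℝ V ∧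
      ∀ v ∈ W, v ∉ convexHull ℝ ((W : Set (Eucl n)) \ {v}) := by
  classical
  obtain ⟨W, hW, hmin⟩ := WellFounded.has_min (wellFounded_lt (α := Finset (Eucl n)))
    {W : Finset (Eucl n) | convexHull ℝ (W : Set (Eucl n)) = convexHull ℝ V}
    ⟨hV.toFinset, by simp⟩
  refine ⟨W, hW, fun v hv hmem => hmin (W.erase v) ?_ (Finset.erase_ssubset hv)⟩
  rw [mem_ofPred_eq, Finset.coe_erase, ← show convexHull ℝ (W : Set (Eucl n)) = _ from hW]
  refine (convexHull_mono sdiff_subset).antisymm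
    (convexHull_min (fun w hw => ?_) (convex_convexHull ℝ _))
  by_cases h : w = v
  · exact h ▸ hmem
  · exact subset_convexHull ℝ _ ⟨hw, h⟩

/-- A polytope with non-empty interior that is not a simplex has a vertex in the affine span of
the others. -/
theorem exists_mem_affineSpan_diff {n : ℕ} {W : Finset (Eucl n)}
    (hint : (interior (convexHull ℝ (W : Set (Eucl n)))).Nonempty)
    (hns : ¬ IsNSimplex (convexHull ℝ (W : Set (Eucl n)))) :
    ∃ v ∈ W, v ∈ affineSpan ℝ ((W : Set (Eucl n)) \ {v}) := by
  -- If an affine basis `t` of the span exhausts `W`, the hull is a simplex; otherwise any vertex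
  -- outside `t` works.
  obtain ⟨t, htW, hspan, hind⟩ := exists_affineIndependent ℝ (Eucl n) (W : Set (Eucl n))
  by_cases hWt : (W : Set (Eucl n)) ⊆ t
  · obtain rfl := htW.antisymm hWt
    exfalso
    apply hns
    have htop := interior_convexHull_nonempty_iff_affineSpan_eq_top.mp hint
    have hcard := hind.affineSpan_eq_top_iff_card_eq_finrank_add_one.mp (by simpa using htop)
    rw [finrank_euclideanSpace_fin] at hcard
    let e := (Fintype.equivFinOfCardEq hcard).symm
    refine ⟨fun i => (e i : Eucl n), hind.comp_embedding e.toEmbedding, ?_⟩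
    congr 1
    ext w
    exact ⟨fun hw => ⟨e.symm ⟨w, hw⟩, by simp⟩, by rintro ⟨i, rfl⟩; exact (e i).2⟩
  · obtain ⟨v, hv, hvt⟩ := not_subset.mp hWt
    have hsub : t ⊆ (W : Set (Eucl n)) \ {v} := fun w hw => ⟨htW hw, by rintro rfl; exact hvt hw⟩
    refine ⟨v, hv, affineSpan_mono ℝ hsub ?_⟩
    rw [hspan]
    exact subset_affineSpan ℝ _ hv

/-! ### Truncating a polytope -/

/-- For every point of a convex body other than a one-point set there is an outer normal in the
support of the surface area measure whose face misses the point. -/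
theorem IsBody.exists_mem_support_notMem_faceIn {n : ℕ} {K : Set (Eucl n)} (hK : IsBody K)
    {v w : Eucl n} (hv : v ∈ K) (hw : w ∈ K) (hvw : w ≠ v) :
    ∃ u ∈ (surfaceAreaMeasure K hK).support, v ∉ faceIn K (u : Eucl n) := by
  by_contra! hcon
  obtain ⟨R, hR⟩ := hK.isCompact.isBounded.exists_norm_le
  -- If every support inequality is tight at `v`, `K` is a cone with apex `v` and contains this ray,
  -- against boundedness.
  have hray : ∀ s : ℝ, 0 ≤ s → v + s • (w - v) ∈ K := fun s hs =>
    hK.mem_of_forall_support fun u hu => by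
      have h1 := (hcon u hu).2
      have h2 := hK.le_supportFun hw (u : Eucl n)
      rw [inner_add_left, real_inner_smul_left, inner_sub_left]
      nlinarith
  have hpos : 0 < ‖w - v‖ := norm_pos_iff.mpr (sub_ne_zero.mpr hvw)
  have hR0 : 0 ≤ R := (norm_nonneg _).trans (hR v hv)
  have h1 := hR _ (hray ((2 * R + 1) / ‖w - v‖) (by positivity))
  have h2 : ‖((2 * R + 1) / ‖w - v‖) • (w - v)‖ = 2 * R + 1 := by
    rw [norm_smul, Real.norm_of_nonneg (by positivity), div_mul_cancel₀ _ hpos.ne']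
  have h3 := norm_sub_le (v + ((2 * R + 1) / ‖w - v‖) • (w - v)) v
  rw [add_sub_cancel_left, h2] at h3
  have := hR v hv
  linarith

/-- Cutting a convex body by a half-space with an inner point on its open side. -/
theorem IsBody.inter_halfspace {n : ℕ} {K : Set (Eucl n)} (hK : IsBody K) {v u : Eucl n} {c : ℝ}
    (hv : v ∈ K) (hvc : inner ℝ v u < c) : IsBody (K ∩ {x | inner ℝ x u ≤ c}) where
  isCompact := hK.isCompact.inter_right (isClosed_le (by fun_prop) (by fun_prop))
  convex := hK.convex.inter (convex_halfSpace_le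
    (f := fun x : Eucl n => inner ℝ x u)
    ⟨fun x y => inner_add_left x y u, fun a x => real_inner_smul_left x u a⟩ c)
  interior_nonempty := by
    obtain ⟨q, hq⟩ := hK.interior_nonempty
    have hopen : IsOpen {x : Eucl n | inner ℝ x u < c} := isOpen_lt (by fun_prop) (by fun_prop)
    have hvcl : v ∈ closure (interior K) := by
      rw [hK.convex.closure_interior_eq_closure_of_nonempty_interior hK.interior_nonempty]
      exact subset_closure hv
    obtain ⟨y, hy1, hy2⟩ := mem_closure_iff.mp hvcl _ hopen hvc
    refine ⟨y, ?_⟩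
    rw [interior_inter]
    exact ⟨hy2, interior_maximal (fun z (hz : inner ℝ z u < c) => hz.le) hopen hy1⟩

/-- If the truncation of a polytope is homothetic to the polytope, then at most one vertex
survives. -/
theorem eq_of_areHomothetic_truncation {n : ℕ} {W : Finset (Eucl n)} {L : Set (Eucl n)}
    (hW : ∀ v ∈ W, v ∉ convexHull ℝ ((W : Set (Eucl n)) \ {v}))
    (hL : L ⊂ convexHull ℝ (W : Set (Eucl n)))
    (hom : AreHomothetic (convexHull ℝ (W : Set (Eucl n))) L)
    {v w : Eucl n} (hv : v ∈ W) (hw : w ∈ W) (hvL : v ∈ L) (hwL : w ∈ L) : v = w := by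
  obtain ⟨t, ht, x, rfl⟩ := hom
  have hφ : ∀ y ∈ convexHull ℝ (W : Set (Eucl n)),
      x + t • y ∈ {x} + t • convexHull ℝ (W : Set (Eucl n)) :=
    fun y hy => add_mem_add rfl (smul_mem_smul_set hy)
  -- Choose `u` for which `v` is the unique maximiser on `P`. Writing `v` as the image of `v'`, the
  -- image of `v` is no higher than `v` in direction `u`, so `v'` is no lower than `v`; hence `v' =
  -- v`.
  have hfix : ∀ v ∈ W, v ∈ {x} + t • convexHull ℝ (W : Set (Eucl n)) → x + t • v = v := by
    intro v hv hvL
    obtain ⟨x', hx', _, ⟨v', hv', rfl⟩, h⟩ := hvL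
    rw [mem_singleton_iff] at hx'
    obtain ⟨u, hu⟩ := exists_inner_lt_of_notMem_convexHull (W.finite_toSet.sdiff) (hW v hv)
    have hWu : ∀ w ∈ W, inner ℝ w u ≤ inner ℝ v u := fun w hw => by
      by_cases hwv : w = v
      · rw [hwv]
      · exact (hu w ⟨hw, hwv⟩).le
    have hPu : ∀ y ∈ convexHull ℝ (W : Set (Eucl n)), inner ℝ y u ≤ inner ℝ v u := fun y hy =>
      convexHull_min hWu (convex_halfSpace_le (f := fun x : Eucl n => inner ℝ x u)
        ⟨fun x y => inner_add_left x y u, fun a x => real_inner_smul_left x u a⟩ _) hy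
    have hv'v : x + t • v' = v := hx' ▸ h
    have hle : inner ℝ v u ≤ inner ℝ v' u := by
      have h1 := hPu _ (hL.1 (hφ v (subset_convexHull ℝ _ hv)))
      have h2 := congrArg (fun z => inner ℝ z u) hv'v
      simp only [inner_add_left, real_inner_smul_left] at h1 h2
      exact le_of_mul_le_mul_left (by linarith) ht
    have hmem := mem_convexHull_filter_inner_eq hv' hWu hle
    have hsub : {w : Eucl n | w ∈ W ∧ inner ℝ w u = inner ℝ v u} ⊆ {v} := fun w hw => by
      by_contra hwv
      exact (hu w ⟨hw.1, hwv⟩).ne hw.2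
    have hvv := convexHull_mono hsub hmem
    rw [convexHull_singleton, mem_singleton_iff] at hvv
    rwa [hvv] at hv'v
  have e1 := hfix v hv hvL
  have e2 := hfix w hw hwL
  by_contra hvw
  -- Two fixed points force the homothety to be the identity, contradicting that the truncation is
  -- proper.
  have h3 : (1 - t) • (v - w) = 0 := by
    have : (1 - t) • (v - w) = (v - (x + t • v)) - (w - (x + t • w)) := by module
    rw [this, e1, e2, sub_self, sub_self, sub_self]
  have ht1 : t = 1 :=
    (sub_eq_zero.mp ((smul_eq_zero.mp h3).resolve_right (sub_ne_zero.mpr hvw))).symm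
  subst ht1
  have hx : x = 0 := by simpa using e1
  subst hx
  exact hL.2 (by simp)

/-- Every full-dimensional polytope that is not a simplex is weakly decomposable. -/
theorem IsFullPolytope.isWeaklyDecomposable {n : ℕ} {P : Set (Eucl n)} (hP : IsFullPolytope P)
    (hns : ¬ IsNSimplex P) : IsWeaklyDecomposable P := by
  obtain ⟨⟨V, hV, hPV⟩, hint⟩ := hP
  obtain ⟨W, hWV, hW⟩ := exists_finset_convexHull_eq hV
  obtain rfl : P = convexHull ℝ (W : Set (Eucl n)) := hPV.trans hWV.symm
  clear hPV hWV hV V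
  set P := convexHull ℝ (W : Set (Eucl n)) with hPdef
  have hWP : ∀ w ∈ W, w ∈ P := fun w hw => subset_convexHull ℝ _ hw
  have hPb : IsBody P := ⟨W.finite_toSet.isCompact_convexHull (𝕜 := ℝ), convex_convexHull ℝ _, hint⟩
  obtain ⟨v, hv, hvspan⟩ := exists_mem_affineSpan_diff hint hns
  obtain ⟨w₀, hw₀⟩ : ((W : Set (Eucl n)) \ {v}).Nonempty :=
    (affineSpan_nonempty ℝ).mp ⟨v, hvspan⟩
  obtain ⟨u, huC, hvu⟩ := hPb.exists_mem_support_notMem_faceIn (hWP v hv) (hWP w₀ hw₀.1) hw₀.2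
  set a := supportFun P (u : Eucl n) with ha
  have hle : ∀ x ∈ P, inner ℝ x (u : Eucl n) ≤ a := fun x hx => hPb.le_supportFun hx _
  have hva : inner ℝ v (u : Eucl n) < a :=
    lt_of_le_of_ne (hle v (hWP v hv)) fun h => hvu ⟨hWP v hv, h⟩
  -- a level between the face and the remaining vertices
  obtain ⟨c, hca, hc⟩ : ∃ c < a, ∀ w ∈ W, inner ℝ w (u : Eucl n) < a →
      inner ℝ w (u : Eucl n) < c := by
    obtain ⟨m, hm, hmax⟩ := (W.filter fun w => inner ℝ w (u : Eucl n) < a).exists_max_image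
      (fun w => inner ℝ w (u : Eucl n)) ⟨v, Finset.mem_filter.mpr ⟨hv, hva⟩⟩
    obtain ⟨c, hmc, hca⟩ := exists_between (Finset.mem_filter.mp hm).2
    exact ⟨c, hca, fun w hw hwa => (hmax w (Finset.mem_filter.mpr ⟨hw, hwa⟩)).trans_lt hmc⟩
  have hvc := hc v hv hva
  set L := P ∩ {x | inner ℝ x (u : Eucl n) ≤ c} with hLdef
  have hL : IsBody L := hPb.inter_halfspace (hWP v hv) hvc
  have hLP : L ⊆ P := inter_subset_left
  -- the face in direction `u` is not empty, so `L` is a proper subset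
  obtain ⟨p, hp, hpa⟩ : ∃ p ∈ P, inner ℝ p (u : Eucl n) = a := by
    obtain ⟨p, hp, hmax⟩ := hPb.isCompact.exists_isMaxOn ⟨v, hWP v hv⟩
      (f := fun x => inner ℝ x (u : Eucl n)) (by fun_prop)
    exact ⟨p, hp, (hPb.mem_faceIn.mpr ⟨hp, hmax⟩).2⟩
  have hLss : L ⊂ P := ⟨hLP, fun h => by
    have : inner ℝ p (u : Eucl n) ≤ c := (h hp).2
    linarith⟩
  refine ⟨hPb, L, hL, fun hom => ?_, ?_⟩
  · -- all vertices other than `v` lie in the face, hence so does `v`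
    have hface : (W : Set (Eucl n)) \ {v} ⊆ {x | inner ℝ x (u : Eucl n) = a} := by
      rintro w ⟨hw, hwv⟩
      by_contra hne
      have hwc := hc w hw (lt_of_le_of_ne (hle w (hWP w hw)) hne)
      exact hwv (eq_of_areHomothetic_truncation hW hLss hom hw hv ⟨hWP w hw, hwc.le⟩
        ⟨hWP v hv, hvc.le⟩)
    have hspan : ∀ x ∈ affineSpan ℝ ((W : Set (Eucl n)) \ {v}),
        inner ℝ x (u : Eucl n) = a := by
      intro x hx
      refine affineSpan_induction hx (fun x hx => hface hx) fun r x y z hx hy hz => ?_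
      simp only [vsub_eq_sub, vadd_eq_add, inner_add_left, real_inner_smul_left,
        inner_sub_left, hx, hy, hz]
      ring
    exact hva.ne (hspan v hvspan)
  · refine (hPb.add hL).support_subset_of_forall_mem_faceIn isClosed_support ?_
    rintro w z hz
    rw [(hPb.add hL).mem_faceIn] at hz
    obtain ⟨⟨x, hx, y, hy, rfl⟩, hmax⟩ := hz
    have hxmax : ∀ x' ∈ P, inner ℝ x' (w : Eucl n) ≤ inner ℝ x (w : Eucl n) := fun x' hx' => by
      have := hmax _ (add_mem_add hx' hy)
      simpa [inner_add_left] using this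
    have hymax : ∀ y' ∈ L, inner ℝ y' (w : Eucl n) ≤ inner ℝ y (w : Eucl n) := fun y' hy' => by
      have := hmax _ (add_mem_add hx hy')
      simpa [inner_add_left] using this
    have hsum : ∀ u' : USphere n, (∀ x' ∈ P, inner ℝ x' (u' : Eucl n) ≤ inner ℝ x (u' : Eucl n)) →
        (∀ y' ∈ L, inner ℝ y' (u' : Eucl n) ≤ inner ℝ y (u' : Eucl n)) →
        x + y ∈ faceIn (P + L) (u' : Eucl n) := by
      intro u' h1 h2
      refine (hPb.add hL).mem_faceIn.mpr ⟨add_mem_add hx hy, ?_⟩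
      rintro _ ⟨x', hx', y', hy', rfl⟩
      simp only [inner_add_left]
      exact add_le_add (h1 x' hx') (h2 y' hy')
    -- Either the cut leaves the support value in direction `w` unchanged, or it lowers it. In the
    -- second case the cutting normal `u` itself serves.
    by_cases hyx : inner ℝ x (w : Eucl n) ≤ inner ℝ y (w : Eucl n)
    · -- `x` and `y` lie in a common face of `P`
      -- A normal at the midpoint is a normal at both `x` and `y`, so one support direction serves
      -- both summands.
      have hm : (1 / 2 : ℝ) • x + (1 / 2 : ℝ) • y ∈ faceIn P (w : Eucl n) := by
        refine hPb.mem_faceIn.mpr ⟨hPb.convex hx (hLP hy) (by norm_num) (by norm_num)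
          (by norm_num), fun x' hx' => ?_⟩
        have := hxmax x' hx'
        simp only [inner_add_left, real_inner_smul_left]
        linarith
      obtain ⟨u', hu', hmu'⟩ := hPb.exists_mem_support_of_mem_faceIn hm
      have hmax' := (hPb.mem_faceIn.mp hmu').2
      simp only [inner_add_left, real_inner_smul_left] at hmax'
      have h1 := hmax' x hx
      have h2 := hmax' y (hLP hy)
      exact ⟨u', hu', hsum u' (fun x' hx' => by linarith [hmax' x' hx'])
        (fun y' hy' => by linarith [hmax' y' (hLP hy')])⟩
    · push Not at hyx
      refine ⟨u, huC, hsum u ?_ ?_⟩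
      · -- the vertices of the face of `x` are cut off
        have hxF := mem_convexHull_filter_inner_eq hx (fun w' hw' => hxmax w' (hWP w' hw')) le_rfl
        have hsub : {w' : Eucl n | w' ∈ W ∧ inner ℝ w' (w : Eucl n) = inner ℝ x (w : Eucl n)} ⊆
            {x' : Eucl n | a ≤ inner ℝ x' (u : Eucl n)} := by
          rintro w' ⟨hw', he⟩
          by_contra hlt
          have hlt' : inner ℝ w' (u : Eucl n) < a := not_le.mp hlt
          have := hymax w' ⟨hWP w' hw', (hc w' hw' hlt').le⟩
          linarith
        have hxa : a ≤ inner ℝ x (u : Eucl n) := convexHull_min hsub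
          (convex_halfSpace_ge (f := fun x : Eucl n => inner ℝ x (u : Eucl n))
            ⟨fun x y => inner_add_left x y _, fun r x => real_inner_smul_left x _ r⟩ _) hxF
        exact fun x' hx' => (hle x' hx').trans hxa
      · -- `y` lies on the cutting hyperplane
        suffices hyc : c ≤ inner ℝ y (u : Eucl n) from fun y' hy' => le_trans hy'.2 hyc
        by_contra hlt
        push Not at hlt
        -- Below the cutting level `y` could move a little towards `x` inside `L`, strictly
        -- increasing its `w`-component.
        have hev : ∀ᶠ s in nhds (0 : ℝ),
            inner ℝ (y + s • (x - y)) (u : Eucl n) < c ∧ s < 1 :=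
          (ContinuousAt.eventually_lt (f := fun s : ℝ => inner ℝ (y + s • (x - y)) (u : Eucl n))
            (g := fun _ => c) (by fun_prop) (by fun_prop) (by simpa using hlt)).and
            (eventually_lt_nhds zero_lt_one)
        obtain ⟨ε, hε, hball⟩ := Metric.eventually_nhds_iff.mp hev
        obtain ⟨h1, h2⟩ := hball (y := ε / 2) (by
          rw [Real.dist_eq, sub_zero, abs_of_pos (by positivity)]; linarith)
        have h3 := hymax (y + (ε / 2) • (x - y))
          ⟨hPb.convex.add_smul_sub_mem (hLP hy) hx ⟨by positivity, h2.le⟩, h1.le⟩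
        rw [inner_add_left, real_inner_smul_left, inner_sub_left] at h3
        nlinarith

/-! ### Simplices and barycentric coordinates -/

/-- Cancellation of a compact summand. -/
theorem IsBody.mem_of_forall_add_mem_add {n : ℕ} {K L : Set (Eucl n)} (hK : IsBody K)
    (hL : IsBody L) {y : Eucl n} (h : ∀ p ∈ K, p + y ∈ K + L) : y ∈ L := by
  by_contra hy
  obtain ⟨f, c, hfy, hfL⟩ :=
    geometric_hahn_banach_point_closed hL.convex hL.isCompact.isClosed hy
  -- With `p` minimising `f` on `K`, any decomposition `p + y = p' + l` forces `f l ≤ f y`, against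
  -- the separation.
  obtain ⟨p, hp, hmin⟩ := hK.isCompact.exists_isMinOn
    (hK.interior_nonempty.mono interior_subset) f.continuous.continuousOn
  obtain ⟨p', hp', l, hl, hpl⟩ := h p hp
  have h1 := congrArg f hpl
  have h2 : f p ≤ f p' := hmin hp'
  have h3 := hfL l hl
  simp only [map_add] at h1
  linarith

/-- The facet normals of a simplex, with the barycentric coordinates expressed through them. -/
theorem AffineBasis.exists_normals {n : ℕ} (hn : 0 < n) (b : AffineBasis (Fin (n + 1)) ℝ (Eucl n)) :
    ∃ (u : Fin (n + 1) → USphere n) (r : Fin (n + 1) → ℝ), (∀ i, 0 < r i) ∧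
      ∀ i x, b.coord i x = b.coord i 0 - r i * inner ℝ x (u i : Eucl n) := by
  have hex : ∀ i, ∃ (u : USphere n) (r : ℝ), 0 < r ∧
      ∀ x, b.coord i x = b.coord i 0 - r * inner ℝ x (u : Eucl n) := by
    intro i
    set a := (InnerProductSpace.toDual ℝ (Eucl n)).symm
      (LinearMap.toContinuousLinearMap (b.coord i).linear) with ha
    have hca : ∀ x, b.coord i x = b.coord i 0 + inner ℝ x a := by
      intro x
      rw [real_inner_comm, ha, InnerProductSpace.toDual_symm_apply,
        LinearMap.coe_toContinuousLinearMap']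
      have := (b.coord i).map_vadd 0 x
      rw [vadd_eq_add, add_zero, vadd_eq_add] at this
      rw [this]
      exact add_comm _ _
    have ha0 : a ≠ 0 := by
      intro h0
      have : Nontrivial (Fin (n + 1)) := Fin.nontrivial_iff_two_le.mpr (by omega)
      obtain ⟨j, hj⟩ := exists_ne i
      have h1 := hca (b i)
      have h2 := hca (b j)
      rw [h0, inner_zero_right] at h1 h2
      rw [b.coord_apply_eq] at h1
      rw [b.coord_apply_ne hj.symm] at h2
      linarith
    -- The sign makes `u` point out of the simplex: the coordinate decreases along it.
    obtain ⟨u, r, hr, hur⟩ := exists_sphere_smul (neg_ne_zero.mpr ha0)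
    refine ⟨u, r, hr, fun x => ?_⟩
    rw [← real_inner_smul_right, ← hur, inner_neg_right, sub_neg_eq_add, hca]
  choose u r hr hur using hex
  exact ⟨u, r, hr, hur⟩

/-- A convex body whose sum with a simplex has only the facet normals of the simplex is homothetic
to the simplex. -/
theorem AffineBasis.areHomothetic_of_support_subset {n : ℕ} (hn : 0 < n)
    (b : AffineBasis (Fin (n + 1)) ℝ (Eucl n)) {L : Set (Eucl n)}
    (hK : IsBody (convexHull ℝ (range b))) (hL : IsBody L)
    (hsupp : (surfaceAreaMeasure (convexHull ℝ (range b) + L) (hK.add hL)).support ⊆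
      (surfaceAreaMeasure (convexHull ℝ (range b)) hK).support) :
    AreHomothetic (convexHull ℝ (range b)) L := by
  obtain ⟨u, r, hr, hur⟩ := b.exists_normals hn
  have hmem : ∀ x, x ∈ convexHull ℝ (range b) ↔ ∀ i, 0 ≤ b.coord i x := fun x => by
    rw [b.convexHull_eq_nonneg_coord]; rfl
  have hbary : ∀ i x y, b.coord i x ≤ b.coord i y ↔
      inner ℝ y (u i : Eucl n) ≤ inner ℝ x (u i : Eucl n) := fun i x y => by
    rw [hur i x, hur i y, sub_le_sub_iff_left, mul_le_mul_iff_right₀ (hr i)]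
  have hadd : ∀ i x y, b.coord i (x + y) = b.coord i x + b.coord i y - b.coord i 0 :=
    fun i x y => by
      rw [hur i (x + y), hur i x, hur i y, inner_add_left]; ring
  have hsmul : ∀ i (t : ℝ) x, b.coord i (t • x) = t * b.coord i x + (1 - t) * b.coord i 0 :=
    fun i t x => by
      rw [hur i (t • x), hur i x, real_inner_smul_left]; ring
  -- the surface area measure of the simplex is supported by the facet normals
  have hsuppK : (surfaceAreaMeasure (convexHull ℝ (range b)) hK).support ⊆ range u := by
    refine hK.support_subset_of_forall_mem_faceIn (finite_range u).isClosed fun w x hx => ?_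
    have hxi := hK.notMem_interior_of_mem_faceIn hx
    rw [b.interior_convexHull, mem_ofPred_eq] at hxi
    push Not at hxi
    obtain ⟨i, hi⟩ := hxi
    exact ⟨u i, ⟨i, rfl⟩, hK.mem_faceIn.mpr ⟨hx.1, fun y hy =>
      (hbary i x y).mp (hi.trans ((hmem y).mp hy i))⟩⟩
  -- `L` is cut out by its supporting half-spaces with these normals
  have hmin : ∀ i, ∃ l ∈ L, ∀ y ∈ L, b.coord i l ≤ b.coord i y := fun i => by
    obtain ⟨l, hl, hmin⟩ := hL.isCompact.exists_isMinOn
      (hL.interior_nonempty.mono interior_subset)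
      (f := b.coord i) (b.coord i).continuous_of_finiteDimensional.continuousOn
    exact ⟨l, hl, fun y hy => hmin hy⟩
  choose l hlL hl using hmin
  have hLmem : ∀ y, (∀ i, b.coord i (l i) ≤ b.coord i y) → y ∈ L := by
    intro y hy
    refine hK.mem_of_forall_add_mem_add hL fun p hp => ?_
    refine (hK.add hL).mem_of_forall_support fun w hw => ?_
    obtain ⟨i, rfl⟩ := hsuppK (hsupp hw)
    have : Nontrivial (Fin (n + 1)) := Fin.nontrivial_iff_two_le.mpr (by omega)
    -- The vertex `b j` lies on the facet opposite `b i`, so `b j + l i` minimises the `i`-th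
    -- coordinate on the sum and realises its support value.
    obtain ⟨j, hj⟩ := exists_ne i
    have hbj : b j ∈ convexHull ℝ (range b) := subset_convexHull ℝ _ ⟨j, rfl⟩
    refine le_trans ?_ ((hK.add hL).le_supportFun (add_mem_add hbj (hlL i)) _)
    rw [← hbary, hadd, hadd, b.coord_apply_ne hj.symm]
    have := (hmem p).mp hp i
    have := hy i
    linarith
  -- Coordinates sum to one, so `t` is the total freedom left by the lower bounds; an interior point
  -- of `L` exceeds each bound strictly, whence `t > 0`.
  set t : ℝ := 1 - ∑ i, b.coord i (l i) with ht
  have htpos : 0 < t := by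
    obtain ⟨y, hy⟩ := hL.interior_nonempty
    have hlt : ∀ i, b.coord i (l i) < b.coord i y := by
      intro i
      refine lt_of_le_of_ne (hl i y (interior_subset hy)) fun heq => ?_
      refine hL.notMem_interior_of_mem_faceIn (u := u i) (hL.mem_faceIn.mpr
        ⟨interior_subset hy, fun z hz => (hbary i y z).mp (heq ▸ hl i z hz)⟩) hy
    have := Finset.sum_lt_sum_of_nonempty (s := Finset.univ) Finset.univ_nonempty
      (fun i _ => hlt i)
    rw [b.sum_coord_apply_eq_one] at this
    linarith
  -- The coordinates of the translation vector. The term `t * b.coord i 0` compensates for the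
  -- coordinates being affine rather than linear, so that `z ↦ x + t • z` turns the bounds `0` into
  -- the bounds `b.coord i (l i)`.
  set κ : Fin (n + 1) → ℝ := fun i => b.coord i (l i) + t * b.coord i 0 with hκ
  have hκ1 : ∑ i, κ i = 1 := by
    simp only [hκ, Finset.sum_add_distrib, ← Finset.mul_sum, b.sum_coord_apply_eq_one]
    linarith
  set x := Finset.univ.affineCombination ℝ b κ with hx
  have hxκ : ∀ i, b.coord i x = κ i := fun i =>
    b.coord_apply_combination_of_mem (Finset.mem_univ i) hκ1
  have hxt : ∀ i z, b.coord i (x + t • z) = b.coord i (l i) + t * b.coord i z := fun i z => by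
    rw [hadd, hsmul, hxκ, hκ]; ring
  refine ⟨t, htpos, x, Subset.antisymm (fun y hy => ?_) ?_⟩
  · have hyz : x + t • (t⁻¹ • (y - x)) = y := by
      rw [smul_smul, mul_inv_cancel₀ htpos.ne', one_smul, add_sub_cancel]
    rw [← hyz]
    refine add_mem_add rfl (smul_mem_smul_set ((hmem _).mpr fun i => ?_))
    have h1 := hl i y hy
    rw [← hyz, hxt] at h1
    exact nonneg_of_mul_nonneg_right (by linarith) htpos
  · rintro _ ⟨x', hx', _, ⟨z, hz, rfl⟩, rfl⟩
    rw [mem_singleton_iff] at hx'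
    subst hx'
    refine hLmem _ fun i => ?_
    have := hxt i z
    have := mul_nonneg htpos.le ((hmem z).mp hz i)
    change _ ≤ b.coord i (x + t • z)
    linarith

/-- A simplex is not weakly decomposable. -/
theorem IsNSimplex.not_isWeaklyDecomposable {n : ℕ} {P : Set (Eucl n)} (hP : IsNSimplex P) :
    ¬ IsWeaklyDecomposable P := by
  rintro ⟨hK, L, hL, hhom, hsupp⟩
  apply hhom
  obtain ⟨v, hv, rfl⟩ := hP
  -- In dimension zero there are no facet normals, but every body is the whole one-point space.
  rcases Nat.eq_zero_or_pos n with rfl | hn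
  · have hP := (hK.interior_nonempty.mono interior_subset).eq_univ
    have hL := (hL.interior_nonempty.mono interior_subset).eq_univ
    exact ⟨1, one_pos, 0, by rw [hP, hL]; simp⟩
  · exact AffineBasis.areHomothetic_of_support_subset hn
      ⟨v, hv, hv.affineSpan_eq_top_iff_card_eq_finrank_add_one.mpr (by simp)⟩ hK hL hsupp

theorem mainTheorem7 (n : ℕ) :
    (∀ P : Set (Eucl n), IsFullPolytope P → ¬ IsNSimplex P → IsWeaklyDecomposable P) ∧
    (∀ P : Set (Eucl n), IsNSimplex P → ¬ IsWeaklyDecomposable P) ∧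
    (2 ≤ n →
      (∀ K : Set (Eucl n), IsWeaklyDecomposable K → 1 < bezoutConst₂ K) →
      ∀ P : Set (Eucl n), IsFullPolytope P → ¬ IsNSimplex P → 1 < bezoutConst₂ P) :=
  ⟨fun _ => IsFullPolytope.isWeaklyDecomposable, fun _ => IsNSimplex.not_isWeaklyDecomposable,
    fun _ h P hP hns => h P (hP.isWeaklyDecomposable hns)⟩
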